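/- Let $p\in(1,\infty)$, $r\in(0,\infty)$ and let $m\ge 2$ be an integer. Write $\mathcal L^p=L^p([0,1],\mathbb R)$ with its usual norm $\|\cdot\|_p$, and $B_{p,r}=\{q\in\mathcal L^p:\|q\|_p\le r\}$. For $q\in\mathcal L^p$, a number $\lambda\in\mathbb R$ is a Dirichlet eigenvalue of $q$ if there is a function $\psi\not\equiv 0$ on $[0,1]$, differentiable with absolutely continuous derivative, such that $-\psi''+q\psi=\lambda\psi$ almost everywhere on $[0,1]$ and $\psi(0)=\psi(1)=0$. For every $q\in\mathcal L^p$ the Dirichlet eigenvalues of $q$ form a strictly increasing sequence $\lambda_1(q)<\lambda_2(q)<\cdots$; put $\mathscr E_m(q)=\sum_{i=1}^m\lambda_i(q)$. Then there exist potentials $q^-,q^+\in\mathcal L^p$ with $$\|q^-\|_p=\|q^+\|_p=r,\qquad \mathscr E_m(q^-)=\min_{q\in B_{p,r}}\mathscr E_m(q),\qquad \mathscr E_m(q^+)=\max_{q\in B_{p,r}}\mathscr E_m(q).$$ In particular, both the minimum and the maximum exist. -/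

import Mathlib

open MeasureTheory
open scoped ENNReal

noncomputable section

/-- Lebesgue measure on the unit interval `Ω = [0, 1]`. -/
abbrev unitMeasure : Measure ℝ := volume.restrict (Set.Icc (0 : ℝ) 1)

/-- The real Lebesgue space `L^p(Ω, ℝ)`, `Ω = [0, 1]`. -/
abbrev Potential (p : ℝ≥0∞) := Lp ℝ p unitMeasure

/-- `ψ` is a nontrivial solution on `[0, 1]` of `-ψ'' + q ψ = lam ψ`, `ψ 0 = ψ 1 = 0`.
As `q` is only integrable, the equation is meant in the usual (Carathéodory) sense: `ψ` has on
`[0, 1]` a derivative `ψ'` (one-sided at the end points) which is absolutely continuous, and the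
equation holds almost everywhere. -/
def IsDirichletEigenfunction (q : ℝ → ℝ) (lam : ℝ) (ψ : ℝ → ℝ) : Prop :=
  (∃ ψ' : ℝ → ℝ,
    (∀ x ∈ Set.Icc (0 : ℝ) 1, HasDerivWithinAt ψ (ψ' x) (Set.Icc 0 1) x) ∧
    AbsolutelyContinuousOnInterval ψ' 0 1 ∧
    ∀ᵐ x ∂unitMeasure, -deriv ψ' x + q x * ψ x = lam * ψ x) ∧
  ψ 0 = 0 ∧ ψ 1 = 0 ∧ ∃ x ∈ Set.Icc (0 : ℝ) 1, ψ x ≠ 0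

/-- The set of (real) Dirichlet eigenvalues of `-d²/dx² + q` on `[0, 1]`. -/
def dirichletEigenvalues (q : ℝ → ℝ) : Set ℝ :=
  {lam | ∃ ψ : ℝ → ℝ, IsDirichletEigenfunction q lam ψ}

/-- The Dirichlet eigenvalues enumerated from below, starting with index `0`: index `0` is the
smallest eigenvalue, index `i + 1` the smallest eigenvalue greater than the one with index `i`.
So `dirichletEigenvalue q i` is `λ_{i+1}(q)`. -/
def dirichletEigenvalue (q : ℝ → ℝ) : ℕ → ℝ
  | 0 => sInf (dirichletEigenvalues q)
  | i + 1 => sInf {lam | lam ∈ dirichletEigenvalues q ∧ dirichletEigenvalue q i < lam}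

/-- The sum `λ_1(q) + ⋯ + λ_m(q)` of the first `m` eigenvalues. -/
def eigenvalueSum (m : ℕ) (q : ℝ → ℝ) : ℝ :=
  ∑ i ∈ Finset.range m, dirichletEigenvalue q i

/-- The ball `B_{p,r}` of radius `r` centred at the origin of `L^p(Ω, ℝ)`. -/
def potentialBall (p : ℝ≥0∞) (r : ℝ) : Set (Potential p) := {q | ‖q‖ ≤ r}

end

/-! The eigenvalue sum is a continuous function on a compact set, and shifting a potential by a
constant pushes the extremizers to the boundary of the ball.

Weak compactness of the ball is made concrete by replacing a potential `q` with its primitive `Q`.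
Primitives of potentials in the ball share a Hölder modulus with exponent `1 - 1/p`, which is
positive because `p > 1`, so Arzelà–Ascoli applies; the set is also closed under uniform limits
(`isClosed_primitives`, `isCompact_primitives`).

The eigenvalues depend on `q` through `Q` alone. With `v = ψ' - Q ψ` the equation becomes a linear
first-order system whose coefficients contain `Q` but not `q`, and its Prüfer angle `θ` solves a
scalar equation that is Lipschitz in `θ`. The end angle `θ(1)` is continuous in `(Q, λ)` for the sup
norm, strictly increasing in `λ`, positive, and takes every value `(n + 1) π`. These levels are
exactly the eigenvalues (`dirichletEigenvalues_eq_range`), and strict monotonicity makes each of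
them continuous in `Q` (`continuous_pruferEigenvalue`). Hence a minimum and a maximum exist.

Adding a constant `c` to `q` adds `m c` to the sum and changes the norm by at most `|c|`, since the
interval has measure one. An extremizer with norm below `r` could therefore be improved inside the
ball. -/

section

open Set Filter Topology BoundedContinuousFunction

noncomputable section

/-! ### A regularised Prüfer equation -/

/-- The right hand side of the equation for the angle `θ` of `(ψ, ψ' - Q ψ) = ρ (sin θ, cos θ)`,
where `Q` is a primitive of the potential. -/
def pruferField (Q : ℝ →ᵇ ℝ) (lam t θ : ℝ) : ℝ :=
  (Real.cos θ + Q t * Real.sin θ) ^ 2 + lam * Real.sin θ ^ 2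

lemma abs_apply_le_norm (Q : ℝ →ᵇ ℝ) (t : ℝ) : |Q t| ≤ ‖Q‖ := Q.norm_coe_le_norm t

lemma abs_cos_add_mul_sin_le (Q : ℝ →ᵇ ℝ) (t θ : ℝ) :
    |Real.cos θ + Q t * Real.sin θ| ≤ 1 + ‖Q‖ := by
  have h1 := Real.abs_cos_le_one θ
  have h2 := Real.abs_sin_le_one θ
  have h3 := abs_apply_le_norm Q t
  calc _ ≤ |Real.cos θ| + |Q t * Real.sin θ| := abs_add_le _ _
    _ ≤ 1 + ‖Q‖ * 1 := by rw [abs_mul]; gcongr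
    _ = _ := by ring

lemma abs_pruferField_le (Q : ℝ →ᵇ ℝ) (lam t θ : ℝ) :
    |pruferField Q lam t θ| ≤ (1 + ‖Q‖) ^ 2 + |lam| := by
  have h1 := abs_cos_add_mul_sin_le Q t θ
  have h2 := Real.abs_sin_le_one θ
  calc _ ≤ |(Real.cos θ + Q t * Real.sin θ) ^ 2| + |lam * Real.sin θ ^ 2| := abs_add_le _ _
    _ ≤ (1 + ‖Q‖) ^ 2 + |lam| * 1 ^ 2 := by rw [abs_mul, abs_pow, abs_pow]; gcongr
    _ = _ := by ring

lemma abs_cos_sub_cos_le (x y : ℝ) : |Real.cos x - Real.cos y| ≤ |x - y| := by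
  simpa [Real.dist_eq] using Real.lipschitzWith_cos.dist_le_mul x y

lemma abs_sin_sub_sin_le (x y : ℝ) : |Real.sin x - Real.sin y| ≤ |x - y| := by
  simpa [Real.dist_eq] using Real.lipschitzWith_sin.dist_le_mul x y

/-- The Lipschitz constant of the Prüfer field in the angle. -/
def pruferConst (Q : ℝ →ᵇ ℝ) (lam : ℝ) : NNReal := 2 * (1 + ‖Q‖₊) ^ 2 + 2 * ‖lam‖₊

lemma pruferConst_coe (Q : ℝ →ᵇ ℝ) (lam : ℝ) :
    (pruferConst Q lam : ℝ) = 2 * (1 + ‖Q‖) ^ 2 + 2 * |lam| := by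
  simp [pruferConst]

lemma pruferConst_pos (Q : ℝ →ᵇ ℝ) (lam : ℝ) : 0 < (pruferConst Q lam : ℝ) := by
  rw [pruferConst_coe]; positivity

lemma abs_pruferField_sub_le (Q : ℝ →ᵇ ℝ) (lam t x y : ℝ) :
    |pruferField Q lam t x - pruferField Q lam t y| ≤ pruferConst Q lam * |x - y| := by
  have hx := abs_cos_add_mul_sin_le Q t x
  have hy := abs_cos_add_mul_sin_le Q t y
  have h1 := abs_cos_sub_cos_le x y
  have h2 := abs_sin_sub_sin_le x y
  have hsx := Real.abs_sin_le_one x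
  have hsy := Real.abs_sin_le_one y
  have hq := abs_apply_le_norm Q t
  have e : pruferField Q lam t x - pruferField Q lam t y =
      ((Real.cos x + Q t * Real.sin x) + (Real.cos y + Q t * Real.sin y)) *
        ((Real.cos x - Real.cos y) + Q t * (Real.sin x - Real.sin y)) +
      lam * ((Real.sin x + Real.sin y) * (Real.sin x - Real.sin y)) := by
    unfold pruferField; ring
  rw [e, pruferConst_coe]
  calc _ ≤ (|Real.cos x + Q t * Real.sin x| + |Real.cos y + Q t * Real.sin y|) *
        (|Real.cos x - Real.cos y| + |Q t| * |Real.sin x - Real.sin y|) +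
      |lam| * ((|Real.sin x| + |Real.sin y|) * |Real.sin x - Real.sin y|) := by
        refine (abs_add_le _ _).trans ?_
        rw [abs_mul, abs_mul, abs_mul]
        gcongr
        · exact abs_add_le _ _
        · exact (abs_add_le _ _).trans (by rw [abs_mul])
        · exact abs_add_le _ _
    _ ≤ ((1 + ‖Q‖) + (1 + ‖Q‖)) * (|x - y| + ‖Q‖ * |x - y|) +
      |lam| * ((1 + 1) * |x - y|) := by gcongr
    _ = _ := by ring

lemma lipschitzWith_pruferField (Q : ℝ →ᵇ ℝ) (lam t : ℝ) :
    LipschitzWith (pruferConst Q lam) (pruferField Q lam t) :=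
  LipschitzWith.of_dist_le_mul fun x y => by
    simpa [Real.dist_eq] using abs_pruferField_sub_le Q lam t x y

lemma abs_pruferField_sub_pruferField_le (Q Q' : ℝ →ᵇ ℝ) (lam lam' t θ : ℝ) :
    |pruferField Q lam t θ - pruferField Q' lam' t θ| ≤
      (2 + ‖Q‖ + ‖Q'‖) * ‖Q - Q'‖ + |lam - lam'| := by
  have hx := abs_cos_add_mul_sin_le Q t θ
  have hy := abs_cos_add_mul_sin_le Q' t θ
  have hs := Real.abs_sin_le_one θ
  have hq : |Q t - Q' t| ≤ ‖Q - Q'‖ := abs_apply_le_norm (Q - Q') t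
  have e : pruferField Q lam t θ - pruferField Q' lam' t θ =
      ((Real.cos θ + Q t * Real.sin θ) + (Real.cos θ + Q' t * Real.sin θ)) *
        ((Q t - Q' t) * Real.sin θ) + (lam - lam') * Real.sin θ ^ 2 := by
    unfold pruferField; ring
  rw [e]
  calc _ ≤ (|Real.cos θ + Q t * Real.sin θ| + |Real.cos θ + Q' t * Real.sin θ|) *
        (|Q t - Q' t| * |Real.sin θ|) + |lam - lam'| * |Real.sin θ| ^ 2 := by
        refine (abs_add_le _ _).trans ?_
        rw [abs_mul, abs_mul, abs_mul, abs_pow]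
        gcongr
        exact abs_add_le _ _
    _ ≤ ((1 + ‖Q‖) + (1 + ‖Q'‖)) * (‖Q - Q'‖ * 1) + |lam - lam'| * 1 ^ 2 := by gcongr
    _ = _ := by ring

lemma exists_prufer (Q : ℝ →ᵇ ℝ) (lam : ℝ) : ∃ θ : ℝ → ℝ, θ 0 = 0 ∧
    ∀ t ∈ Icc (0 : ℝ) 1, HasDerivWithinAt θ (pruferField Q lam t (θ t)) (Icc 0 1) t := by
  let C : NNReal := (1 + ‖Q‖₊) ^ 2 + ‖lam‖₊
  have hC : (C : ℝ) = (1 + ‖Q‖) ^ 2 + |lam| := by simp [C]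
  -- The field is bounded by `C`, so over unit time a solution stays within distance `C` of its
  -- start; this radius gives existence on all of `[0, 1]`.
  have : IsPicardLindelof (pruferField Q lam) (tmin := 0) (tmax := 1) ⟨0, by simp⟩ (0 : ℝ)
      C 0 C (pruferConst Q lam) :=
    { lipschitzOnWith := fun t _ => (lipschitzWith_pruferField Q lam t).lipschitzOnWith
      continuousOn := fun x _ => by unfold pruferField; fun_prop
      norm_le := fun t _ x _ => by rw [hC]; exact abs_pruferField_le Q lam t x
      mul_max_le := by simp }
  exact this.exists_eq_forall_mem_Icc_hasDerivWithinAt₀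

/-- The Prüfer angle. -/
def prufer (Q : ℝ →ᵇ ℝ) (lam : ℝ) : ℝ → ℝ := (exists_prufer Q lam).choose

@[simp] lemma prufer_zero (Q : ℝ →ᵇ ℝ) (lam : ℝ) : prufer Q lam 0 = 0 :=
  (exists_prufer Q lam).choose_spec.1

lemma hasDerivWithinAt_prufer (Q : ℝ →ᵇ ℝ) (lam : ℝ) {t : ℝ} (ht : t ∈ Icc (0 : ℝ) 1) :
    HasDerivWithinAt (prufer Q lam) (pruferField Q lam t (prufer Q lam t)) (Icc 0 1) t :=
  (exists_prufer Q lam).choose_spec.2 t ht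

lemma hasDerivWithinAt_prufer_Ici (Q : ℝ →ᵇ ℝ) (lam : ℝ) {t : ℝ} (ht : t ∈ Ico (0 : ℝ) 1) :
    HasDerivWithinAt (prufer Q lam) (pruferField Q lam t (prufer Q lam t)) (Ici t) t :=
  (hasDerivWithinAt_prufer Q lam (Ico_subset_Icc_self ht)).mono_of_mem_nhdsWithin
    (Icc_mem_nhdsGE_of_mem ht)

lemma hasDerivAt_prufer (Q : ℝ →ᵇ ℝ) (lam : ℝ) {t : ℝ} (ht : t ∈ Ioo (0 : ℝ) 1) :
    HasDerivAt (prufer Q lam) (pruferField Q lam t (prufer Q lam t)) t :=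
  (hasDerivWithinAt_prufer Q lam (Ioo_subset_Icc_self ht)).hasDerivAt (Icc_mem_nhds ht.1 ht.2)

lemma continuousOn_prufer (Q : ℝ →ᵇ ℝ) (lam : ℝ) : ContinuousOn (prufer Q lam) (Icc 0 1) :=
  fun _ ht => (hasDerivWithinAt_prufer Q lam ht).continuousWithinAt

/-! ### Dependence of the end angle on the primitive and the parameter -/

lemma abs_prufer_one_sub_le (Q Q' : ℝ →ᵇ ℝ) (lam lam' : ℝ) :
    |prufer Q' lam' 1 - prufer Q lam 1| ≤
      ((2 + ‖Q‖ + ‖Q'‖) * ‖Q - Q'‖ + |lam - lam'|) / pruferConst Q lam *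
        (Real.exp (pruferConst Q lam) - 1) := by
  have h := dist_le_of_approx_trajectories_ODE (a := 0) (b := 1) (δ := 0) (εf := 0)
    (εg := (2 + ‖Q‖ + ‖Q'‖) * ‖Q - Q'‖ + |lam - lam'|)
    (v := pruferField Q lam) (lipschitzWith_pruferField Q lam)
    (continuousOn_prufer Q lam) (fun t ht => hasDerivWithinAt_prufer_Ici Q lam ht)
    (fun t _ => by simp)
    (continuousOn_prufer Q' lam') (fun t ht => hasDerivWithinAt_prufer_Ici Q' lam' ht)
    (fun t _ => by
      rw [dist_comm, Real.dist_eq]; exact abs_pruferField_sub_pruferField_le _ _ _ _ _ _)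
    (by simp) 1 (by simp)
  rw [gronwallBound_of_K_ne_0 (pruferConst_pos Q lam).ne', dist_comm, Real.dist_eq] at h
  simpa using h

lemma continuous_prufer_one : Continuous fun z : (ℝ →ᵇ ℝ) × ℝ => prufer z.1 z.2 1 := by
  rw [continuous_iff_continuousAt]
  rintro ⟨Q, lam⟩
  have hc : Continuous fun z : (ℝ →ᵇ ℝ) × ℝ =>
      ((2 + ‖Q‖ + ‖z.1‖) * ‖Q - z.1‖ + |lam - z.2|) / pruferConst Q lam *
        (Real.exp (pruferConst Q lam) - 1) := by fun_prop
  have h0 := hc.tendsto (Q, lam)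
  simp only [sub_self, norm_zero, abs_zero, mul_zero, add_zero, zero_div, zero_mul] at h0
  rw [ContinuousAt, tendsto_iff_dist_tendsto_zero]
  exact squeeze_zero (fun _ => dist_nonneg)
    (fun z => by rw [Real.dist_eq]; exact abs_prufer_one_sub_le Q z.1 lam z.2) h0

lemma pruferField_mono (Q : ℝ →ᵇ ℝ) {lam mu : ℝ} (h : lam ≤ mu) (t θ : ℝ) :
    pruferField Q lam t θ ≤ pruferField Q mu t θ := by
  unfold pruferField; gcongr

lemma prufer_mono (Q : ℝ →ᵇ ℝ) {lam mu : ℝ} (h : lam ≤ mu) {t : ℝ} (ht : t ∈ Icc (0 : ℝ) 1) :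
    prufer Q lam t ≤ prufer Q mu t := by
  set L : ℝ := (↑(pruferConst Q lam) : ℝ)
  -- The perturbation grows at rate `L + 1`, more than the Lipschitz constant `L`, so the
  -- derivatives compare strictly at any contact; then `ε` tends to zero.
  have key : ∀ ε > 0, prufer Q lam t ≤ prufer Q mu t + ε * Real.exp ((L + 1) * t) := by
    intro ε hε
    have hB : ∀ x : ℝ, HasDerivAt (fun x => ε * Real.exp ((L + 1) * x))
        (ε * (Real.exp ((L + 1) * x) * (L + 1))) x := fun x => by
      have := ((hasDerivAt_id x).const_mul (L + 1)).exp.const_mul ε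
      simpa using this
    refine image_le_of_deriv_right_lt_deriv_boundary' (continuousOn_prufer Q lam)
      (fun x hx => hasDerivWithinAt_prufer_Ici Q lam hx)
      (B := fun x => prufer Q mu x + ε * Real.exp ((L + 1) * x))
      (B' := fun x => pruferField Q mu x (prufer Q mu x) +
        ε * (Real.exp ((L + 1) * x) * (L + 1)))
      (by simp [hε.le]) ((continuousOn_prufer Q mu).add (by fun_prop))
      (fun x hx => (hasDerivWithinAt_prufer_Ici Q mu hx).add (hB x).hasDerivWithinAt)
      (fun x _ hxe => ?_) ht
    have h1 := abs_pruferField_sub_le Q lam x (prufer Q lam x) (prufer Q mu x)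
    have h2 := pruferField_mono Q h x (prufer Q mu x)
    have h3 : |prufer Q lam x - prufer Q mu x| = ε * Real.exp ((L + 1) * x) := by
      rw [hxe, add_sub_cancel_left, abs_of_pos (by positivity)]
    rw [h3] at h1
    have h4 := (abs_le.1 h1).2
    have h5 : 0 < ε * Real.exp ((L + 1) * x) := by positivity
    have h6 : ε * (Real.exp ((L + 1) * x) * (L + 1)) =
      L * (ε * Real.exp ((L + 1) * x)) + ε * Real.exp ((L + 1) * x) := by ring
    change _ < _ + _
    linarith
  refine le_of_forall_pos_le_add fun δ hδ => ?_
  have := key (δ / Real.exp ((L + 1) * t)) (by positivity)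
  rwa [div_mul_cancel₀ _ (Real.exp_pos _).ne'] at this

lemma monotoneOn_unitInterval_of_deriv_nonneg {f f' : ℝ → ℝ}
    (hf : ∀ t ∈ Icc (0 : ℝ) 1, HasDerivWithinAt f (f' t) (Icc 0 1) t)
    (h0 : ∀ t ∈ Icc (0 : ℝ) 1, 0 ≤ f' t) : MonotoneOn f (Icc 0 1) :=
  monotoneOn_of_hasDerivWithinAt_nonneg (convex_Icc 0 1)
    (fun t ht => (hf t ht).continuousWithinAt)
    (fun t ht => (hf t (interior_subset ht)).mono interior_subset)
    (fun t ht => h0 t (interior_subset ht))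

/-- Where `sin θ` vanishes its derivative is `cos³ θ`, which is not zero, so `sin θ` cannot vanish
identically. -/
lemma exists_sin_prufer_ne_zero (Q : ℝ →ᵇ ℝ) (lam : ℝ) :
    ∃ t ∈ Ioo (0 : ℝ) 1, Real.sin (prufer Q lam t) ≠ 0 := by
  by_contra! hcon
  have hm : (1 / 2 : ℝ) ∈ Ioo (0 : ℝ) 1 := by norm_num
  have h1 := (hasDerivAt_prufer Q lam hm).sin
  have h2 : HasDerivAt (fun t => Real.sin (prufer Q lam t)) 0 (1 / 2) :=
    (hasDerivAt_const (1 / 2 : ℝ) (0 : ℝ)).congr_of_eventuallyEq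
      (by filter_upwards [isOpen_Ioo.mem_nhds hm] with t ht using hcon t ht)
  have h3 := h1.unique h2
  have hs := hcon _ hm
  have hsc := Real.sin_sq_add_cos_sq (prufer Q lam (1 / 2))
  rw [pruferField, hs] at h3
  rw [hs] at hsc
  have : Real.cos (prufer Q lam (1 / 2)) = 0 := by
    simpa using h3
  rw [this] at hsc
  norm_num at hsc

/-- If the end angles agreed, the difference `w ≥ 0` would vanish at `1`. As `exp (L t) w` is
nondecreasing, `w` would vanish throughout; the two fields would then agree along the common angle,
forcing `(mu - lam) sin² θ = 0`. -/
lemma prufer_one_strictMono (Q : ℝ →ᵇ ℝ) : StrictMono fun lam => prufer Q lam 1 := by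
  intro lam mu h
  refine (prufer_mono Q h.le (by simp)).lt_of_ne fun he => ?_
  set L : ℝ := (↑(pruferConst Q lam) : ℝ)
  have hL : 0 < L := pruferConst_pos Q lam
  set w : ℝ → ℝ := fun t => prufer Q mu t - prufer Q lam t with hw
  have hw0 : ∀ t ∈ Icc (0 : ℝ) 1, 0 ≤ w t := fun t ht => sub_nonneg.2 (prufer_mono Q h.le ht)
  have hd : ∀ t ∈ Icc (0 : ℝ) 1, HasDerivWithinAt w
      (pruferField Q mu t (prufer Q mu t) - pruferField Q lam t (prufer Q lam t)) (Icc 0 1) t :=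
    fun t ht => (hasDerivWithinAt_prufer Q mu ht).sub (hasDerivWithinAt_prufer Q lam ht)
  have he' : ∀ t : ℝ, HasDerivAt (fun t => Real.exp (L * t)) (Real.exp (L * t) * L) t := fun t => by
    simpa using ((hasDerivAt_id t).const_mul L).exp
  have hmono : MonotoneOn (fun t => Real.exp (L * t) * w t) (Icc 0 1) := by
    refine monotoneOn_unitInterval_of_deriv_nonneg
      (fun t ht => (he' t).hasDerivWithinAt.mul (hd t ht)) fun t ht => ?_
    have h1 := abs_pruferField_sub_le Q lam t (prufer Q mu t) (prufer Q lam t)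
    have h2 := pruferField_mono Q h.le t (prufer Q mu t)
    rw [abs_of_nonneg (hw0 t ht)] at h1
    have h3 := (abs_le.1 h1).1
    have h4 : 0 ≤ L * w t + (pruferField Q mu t (prufer Q mu t) -
      pruferField Q lam t (prufer Q lam t)) := by simp only [hw]; linarith
    have := mul_nonneg (Real.exp_pos (L * t)).le h4
    linarith
  have hzero : ∀ t ∈ Icc (0 : ℝ) 1, w t = 0 := by
    intro t ht
    have h1 := hmono ht (right_mem_Icc.2 zero_le_one) ht.2
    have h2 : w 1 = 0 := sub_eq_zero.2 he.symm
    simp only [h2, mul_zero] at h1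
    exact le_antisymm (nonpos_of_mul_nonpos_right h1 (Real.exp_pos _)) (hw0 t ht)
  obtain ⟨t, ht, hs⟩ := exists_sin_prufer_ne_zero Q mu
  have h1 := (hd t (Ioo_subset_Icc_self ht)).hasDerivAt (Icc_mem_nhds ht.1 ht.2)
  have h2 : HasDerivAt w 0 t := (hasDerivAt_const t (0 : ℝ)).congr_of_eventuallyEq
    (by filter_upwards [isOpen_Ioo.mem_nhds ht] with s hs using hzero s (Ioo_subset_Icc_self hs))
  have h3 := h1.unique h2
  have h4 : prufer Q lam t = prufer Q mu t := by
    have := hzero t (Ioo_subset_Icc_self ht)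
    simp only [hw] at this
    linarith
  rw [h4] at h3
  have h5 : (mu - lam) * Real.sin (prufer Q mu t) ^ 2 = 0 := by
    rw [← h3]; unfold pruferField; ring
  have h6 : 0 < (mu - lam) * Real.sin (prufer Q mu t) ^ 2 :=
    mul_pos (sub_pos.2 h) (by positivity)
  linarith

/-! ### Range of the end angle -/

lemma prufer_nonneg (Q : ℝ →ᵇ ℝ) (lam : ℝ) {t : ℝ} (ht : t ∈ Icc (0 : ℝ) 1) :
    0 ≤ prufer Q lam t := by
  have := image_le_of_deriv_right_lt_deriv_boundary' (f := fun x => -prufer Q lam x)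
    (continuousOn_prufer Q lam).neg (fun x hx => (hasDerivWithinAt_prufer_Ici Q lam hx).neg)
    (B := fun _ => 0) (B' := fun _ => 0) (by simp) continuousOn_const
    (fun x _ => hasDerivWithinAt_const _ _ _)
    -- At angle `0` the field equals `1`, so the angle cannot cross `0` downwards.
    (fun x _ hx => by
      have : prufer Q lam x = 0 := by simpa using hx
      simp [this, pruferField]) ht
  simpa using this

lemma prufer_one_pos (Q : ℝ →ᵇ ℝ) (lam : ℝ) : 0 < prufer Q lam 1 :=
  (prufer_nonneg Q (lam - 1) (by simp)).trans_lt (prufer_one_strictMono Q (by simp))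

lemma exists_prufer_one_lt_pi (Q : ℝ →ᵇ ℝ) : ∃ lam, prufer Q lam 1 < Real.pi := by
  -- The level `π / 4` is a barrier: there the field is `((1 + Q)² + λ) / 2`, which is negative
  -- because `(1 + Q)² ≤ 2 + 2 Q²`.
  refine ⟨-2 * ‖Q‖ ^ 2 - 4, lt_of_le_of_lt ?_ (b := Real.pi / 4) (by linarith [Real.pi_pos])⟩
  refine image_le_of_deriv_right_lt_deriv_boundary'
    (continuousOn_prufer Q _) (fun x hx => (hasDerivWithinAt_prufer_Ici Q _ hx))
    (B := fun _ => Real.pi / 4) (B' := fun _ => 0) (by simp; positivity) continuousOn_const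
    (fun x _ => hasDerivWithinAt_const _ _ _)
    (fun x _ hx => ?_) (right_mem_Icc.2 zero_le_one)
  have hq := abs_le.1 (abs_apply_le_norm Q x)
  rw [hx, pruferField, Real.cos_pi_div_four, Real.sin_pi_div_four]
  have h2 : (√2 : ℝ) ^ 2 = 2 := Real.sq_sqrt (by norm_num)
  have : (√2 / 2 + Q x * (√2 / 2)) ^ 2 + (-2 * ‖Q‖ ^ 2 - 4) * (√2 / 2) ^ 2 =
    ((1 + Q x) ^ 2 + (-2 * ‖Q‖ ^ 2 - 4)) * (√2 ^ 2 / 4) := by ring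
  rw [this, h2]
  nlinarith [sq_nonneg (Q x - 1)]

/-- A lift of `φ ↦ arctan (N tan φ)` to the real line. -/
def stretchedAngle (N φ : ℝ) : ℝ :=
  φ + Real.arctan ((N - 1) * (Real.sin φ * Real.cos φ) / (Real.cos φ ^ 2 + N * Real.sin φ ^ 2))

lemma hasDerivAt_stretchedAngle {N : ℝ} (hN : 1 ≤ N) (φ : ℝ) :
    HasDerivAt (stretchedAngle N) (N / (Real.cos φ ^ 2 + N ^ 2 * Real.sin φ ^ 2)) φ := by
  have hsc := Real.sin_sq_add_cos_sq φ
  have hD : 0 < Real.cos φ ^ 2 + N * Real.sin φ ^ 2 := by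
    nlinarith [sq_nonneg (Real.sin φ)]
  have hE : 0 < Real.cos φ ^ 2 + N ^ 2 * Real.sin φ ^ 2 := by
    nlinarith [sq_nonneg (Real.sin φ), mul_self_nonneg (N - 1)]
  have h := (hasDerivAt_id φ).add
    ((((Real.hasDerivAt_sin φ).mul (Real.hasDerivAt_cos φ)).const_mul (N - 1)).div
      (((Real.hasDerivAt_cos φ).pow 2).add (((Real.hasDerivAt_sin φ).pow 2).const_mul N))
      hD.ne').arctan
  refine h.congr_deriv ?_
  simp only [Pi.add_apply, Pi.mul_apply, Pi.pow_apply, Pi.div_apply]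
  generalize Real.cos φ = c at *
  generalize Real.sin φ = s at *
  have e : 1 + ((N - 1) * (s * c) / (c ^ 2 + N * s ^ 2)) ^ 2 =
      (c ^ 2 + N ^ 2 * s ^ 2) / (c ^ 2 + N * s ^ 2) ^ 2 := by
    field_simp
    linear_combination (c ^ 2 + N ^ 2 * s ^ 2) * hsc
  rw [e]
  field_simp
  linear_combination (N * (c ^ 2 - s ^ 2 * N) - c ^ 2 + s ^ 2 * N + N) * hsc

/-- Since `(cos θ + Q sin θ)² ≥ cos² θ / 2 - Q² sin² θ`, the chosen parameter makes the field at
least `(cos² θ + N² sin² θ) / 2`. The stretched angle thus grows at rate at least `N / 2`, and it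
differs from `θ` by less than `π / 2`. -/
lemma exists_lt_prufer_one (Q : ℝ →ᵇ ℝ) (R : ℝ) : ∃ lam, R < prufer Q lam 1 := by
  obtain ⟨N, hN1, hN2⟩ : ∃ N : ℝ, 1 ≤ N ∧ R < N / 2 - Real.pi / 2 :=
    ⟨max 1 (2 * R + Real.pi + 1), le_max_left _ _, by
      linarith [le_max_right 1 (2 * R + Real.pi + 1)]⟩
  refine ⟨‖Q‖ ^ 2 + N ^ 2 / 2, hN2.trans_le ?_⟩
  set θ := prufer Q (‖Q‖ ^ 2 + N ^ 2 / 2)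
  have hmono : MonotoneOn (fun t => stretchedAngle N (θ t) - N / 2 * t) (Icc 0 1) := by
    refine monotoneOn_unitInterval_of_deriv_nonneg (fun t ht =>
      ((hasDerivAt_stretchedAngle hN1 (θ t)).comp_hasDerivWithinAt t
        (hasDerivWithinAt_prufer Q _ ht)).sub
        ((hasDerivWithinAt_id t _).const_mul (N / 2))) fun t ht => ?_
    have hsc := Real.sin_sq_add_cos_sq (θ t)
    have hE : 0 < Real.cos (θ t) ^ 2 + N ^ 2 * Real.sin (θ t) ^ 2 := by
      nlinarith [sq_nonneg (Real.sin (θ t)), mul_self_nonneg (N - 1)]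
    have hq := abs_le.1 (abs_apply_le_norm Q t)
    have hq2 : Q t ^ 2 ≤ ‖Q‖ ^ 2 := by
      rw [← sq_abs]; exact pow_le_pow_left₀ (abs_nonneg _) (abs_apply_le_norm Q t) 2
    have hb : (Real.cos (θ t) ^ 2 + N ^ 2 * Real.sin (θ t) ^ 2) / 2 ≤
        pruferField Q (‖Q‖ ^ 2 + N ^ 2 / 2) t (θ t) := by
      have := mul_le_mul_of_nonneg_right hq2 (sq_nonneg (Real.sin (θ t)))
      unfold pruferField
      nlinarith [sq_nonneg (Real.cos (θ t) + 2 * Q t * Real.sin (θ t))]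
    have := mul_le_mul_of_nonneg_left hb (by positivity :
      0 ≤ N / (Real.cos (θ t) ^ 2 + N ^ 2 * Real.sin (θ t) ^ 2))
    rw [sub_nonneg, mul_one]
    refine le_trans (le_of_eq ?_) this
    field_simp
  have h1 := hmono (left_mem_Icc.2 zero_le_one) (right_mem_Icc.2 zero_le_one) zero_le_one
  have h0 : θ 0 = 0 := prufer_zero _ _
  simp only [h0, stretchedAngle, Real.sin_zero, zero_mul, mul_zero, zero_div, Real.arctan_zero,
    add_zero, sub_zero] at h1
  have := Real.arctan_lt_pi_div_two ((N - 1) * (Real.sin (θ 1) * Real.cos (θ 1)) /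
    (Real.cos (θ 1) ^ 2 + N * Real.sin (θ 1) ^ 2))
  linarith

/-! ### Parameters at which the end angle is a multiple of `π` -/

lemma exists_prufer_one_eq (Q : ℝ →ᵇ ℝ) (n : ℕ) :
    ∃ lam, prufer Q lam 1 = (n + 1) * Real.pi := by
  obtain ⟨a, ha⟩ := exists_prufer_one_lt_pi Q
  obtain ⟨b, hb⟩ := exists_lt_prufer_one Q ((n + 1) * Real.pi)
  have hc : Continuous fun lam => prufer Q lam 1 :=
    continuous_prufer_one.comp (continuous_const.prodMk continuous_id)
  refine mem_range_of_exists_le_of_exists_ge hc ⟨a, ha.le.trans ?_⟩ ⟨b, hb.le⟩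
  nlinarith [Real.pi_pos, (Nat.cast_nonneg n : (0 : ℝ) ≤ n)]

/-- The parameter at which the Prüfer angle reaches `(n + 1) π` at the end point. -/
def pruferEigenvalue (Q : ℝ →ᵇ ℝ) (n : ℕ) : ℝ := (exists_prufer_one_eq Q n).choose

lemma prufer_pruferEigenvalue (Q : ℝ →ᵇ ℝ) (n : ℕ) :
    prufer Q (pruferEigenvalue Q n) 1 = (n + 1) * Real.pi := (exists_prufer_one_eq Q n).choose_spec

lemma strictMono_pruferEigenvalue (Q : ℝ →ᵇ ℝ) : StrictMono (pruferEigenvalue Q) := by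
  intro a b hab
  refine (prufer_one_strictMono Q).lt_iff_lt.1 ?_
  simp only [prufer_pruferEigenvalue]
  have : (a : ℝ) < b := by exact_mod_cast hab
  nlinarith [Real.pi_pos]

lemma mem_range_pruferEigenvalue_iff (Q : ℝ →ᵇ ℝ) (lam : ℝ) :
    lam ∈ range (pruferEigenvalue Q) ↔ Real.sin (prufer Q lam 1) = 0 := by
  constructor
  · rintro ⟨n, rfl⟩
    rw [prufer_pruferEigenvalue]
    exact_mod_cast Real.sin_nat_mul_pi (n + 1)
  · intro h
    obtain ⟨k, hk⟩ := Real.sin_eq_zero_iff.1 h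
    have hpos := prufer_one_pos Q lam
    rw [← hk] at hpos
    have hk0 : 0 < k := by
      have : (0 : ℝ) < k := pos_of_mul_pos_left hpos Real.pi_pos.le
      exact_mod_cast this
    obtain ⟨n, rfl⟩ : ∃ n : ℕ, k = n + 1 := ⟨(k - 1).toNat, by omega⟩
    refine ⟨n, (prufer_one_strictMono Q).injective ?_⟩
    simp only [prufer_pruferEigenvalue, ← hk]
    push_cast
    ring

/-- By strict monotonicity, lying above or below a fixed `a` is a strict inequality for the end
angle at parameter `a`, hence an open condition on `Q`. -/
lemma continuous_pruferEigenvalue (n : ℕ) : Continuous fun Q => pruferEigenvalue Q n := by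
  rw [continuous_iff_continuousAt]
  intro Q
  have hc : ∀ lam, Tendsto (fun Q => prufer Q lam 1) (𝓝 Q) (𝓝 (prufer Q lam 1)) := fun lam =>
    (continuous_prufer_one.comp (continuous_id.prodMk continuous_const)).tendsto Q
  have hm := prufer_one_strictMono Q
  refine tendsto_order.2 ⟨fun a ha => ?_, fun a ha => ?_⟩
  · have h1 := hm ha
    simp only [prufer_pruferEigenvalue] at h1
    filter_upwards [(hc a).eventually_lt_const h1] with Q' hQ'
    refine (prufer_one_strictMono Q').lt_iff_lt.1 ?_
    simpa only [prufer_pruferEigenvalue] using hQ'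
  · have h1 := hm ha
    simp only [prufer_pruferEigenvalue] at h1
    filter_upwards [(hc a).eventually_const_lt h1] with Q' hQ'
    refine (prufer_one_strictMono Q').lt_iff_lt.1 ?_
    simpa only [prufer_pruferEigenvalue] using hQ'

/-! ### Eigenvalues through the Prüfer angle -/

lemma eq_left_of_deriv_eq_zero {f f' : ℝ → ℝ}
    (hf : ∀ t ∈ Icc (0 : ℝ) 1, HasDerivWithinAt f (f' t) (Icc 0 1) t)
    (h0 : ∀ t ∈ Icc (0 : ℝ) 1, f' t = 0) {t : ℝ} (ht : t ∈ Icc (0 : ℝ) 1) : f t = f 0 := by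
  refine constant_of_has_deriv_right_zero (fun t ht => (hf t ht).continuousWithinAt)
    (fun x hx => ?_) t ht
  have h := hf x (Ico_subset_Icc_self hx)
  rw [h0 x (Ico_subset_Icc_self hx)] at h
  exact h.mono_of_mem_nhdsWithin (Icc_mem_nhdsGE_of_mem hx)

/-- The primitive of the restriction of `h` to the unit interval. -/
def unitPrimitive (h : ℝ → ℝ) (x : ℝ) : ℝ :=
  ∫ s in (0 : ℝ)..x, h (projIcc (0 : ℝ) 1 zero_le_one s)

lemma hasDerivWithinAt_unitPrimitive {h : ℝ → ℝ} (hh : ContinuousOn h (Icc 0 1)) {t : ℝ}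
    (ht : t ∈ Icc (0 : ℝ) 1) : HasDerivWithinAt (unitPrimitive h) (h t) (Icc 0 1) t := by
  have hc : Continuous fun s => h (projIcc (0 : ℝ) 1 zero_le_one s) :=
    hh.comp_continuous (continuous_subtype_val.comp continuous_projIcc) fun s => Subtype.coe_prop _
  have := (hc.integral_hasStrictDerivAt 0 t).hasDerivAt.hasDerivWithinAt (s := Icc 0 1)
  rw [projIcc_of_mem zero_le_one ht] at this
  exact this

lemma unitPrimitive_eq {h : ℝ → ℝ} {x : ℝ} (hx : x ∈ Icc (0 : ℝ) 1) :
    unitPrimitive h x = ∫ s in (0 : ℝ)..x, h s := by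
  refine intervalIntegral.integral_congr fun s hs => ?_
  rw [uIcc_of_le hx.1] at hs
  simp only [projIcc_of_mem zero_le_one (⟨hs.1, hs.2.trans hx.2⟩ : s ∈ Icc (0 : ℝ) 1)]

lemma absolutelyContinuousOnInterval_of_hasDerivWithinAt {f f' : ℝ → ℝ}
    (hf : ∀ t ∈ Icc (0 : ℝ) 1, HasDerivWithinAt f (f' t) (Icc 0 1) t)
    (hc : ContinuousOn f' (Icc 0 1)) : AbsolutelyContinuousOnInterval f 0 1 := by
  obtain ⟨C, hC⟩ := isCompact_Icc.exists_bound_of_continuousOn hc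
  have : LipschitzOnWith C.toNNReal f (Icc 0 1) :=
    (convex_Icc 0 1).lipschitzOnWith_of_nnnorm_hasDerivWithin_le hf fun x hx => by
      rw [← NNReal.coe_le_coe, coe_nnnorm]
      exact (hC x hx).trans (Real.le_coe_toNNReal C)
  rw [← uIcc_of_le (zero_le_one' ℝ)] at this
  exact this.absolutelyContinuousOnInterval

lemma ae_mem_Ioo_unit : ∀ᵐ x ∂unitMeasure, x ∈ Ioo (0 : ℝ) 1 := by
  rw [unitMeasure, ← Measure.restrict_congr_set Ioo_ae_eq_Icc]
  exact ae_restrict_mem measurableSet_Ioo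

lemma ae_unit_of_ae {P : ℝ → Prop} (h : ∀ᵐ x, x ∈ uIcc (0 : ℝ) 1 → P x) :
    ∀ᵐ x ∂unitMeasure, P x := by
  rw [uIcc_of_le zero_le_one] at h
  exact (ae_restrict_iff' measurableSet_Icc).2 h

/-- The system for `ψ` and the regularised derivative `v = ψ' - Q ψ`. -/
def IsRegularisedSolution (Q : ℝ → ℝ) (lam : ℝ) (ψ v : ℝ → ℝ) : Prop :=
  ∀ t ∈ Icc (0 : ℝ) 1, HasDerivWithinAt ψ (v t + Q t * ψ t) (Icc 0 1) t ∧
    HasDerivWithinAt v (-lam * ψ t - Q t * v t - Q t ^ 2 * ψ t) (Icc 0 1) t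

lemma IsRegularisedSolution.continuousOn {Q : ℝ → ℝ} {lam : ℝ} {ψ v : ℝ → ℝ}
    (h : IsRegularisedSolution Q lam ψ v) :
    ContinuousOn ψ (Icc 0 1) ∧ ContinuousOn v (Icc 0 1) :=
  ⟨fun t ht => (h t ht).1.continuousWithinAt, fun t ht => (h t ht).2.continuousWithinAt⟩

/-- The logarithmic derivative of the Prüfer radius. -/
def pruferRadialField (Q : ℝ →ᵇ ℝ) (lam t θ : ℝ) : ℝ :=
  Real.sin θ * (Q t * Real.sin θ + Real.cos θ) +
    Real.cos θ * (-lam * Real.sin θ - Q t * Real.cos θ - Q t ^ 2 * Real.sin θ)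

/-- The Prüfer radius. -/
def pruferRadius (Q : ℝ →ᵇ ℝ) (lam t : ℝ) : ℝ :=
  Real.exp (unitPrimitive (fun s => pruferRadialField Q lam s (prufer Q lam s)) t)

lemma pruferRadius_pos (Q : ℝ →ᵇ ℝ) (lam t : ℝ) : 0 < pruferRadius Q lam t := Real.exp_pos _

lemma hasDerivWithinAt_pruferRadius (Q : ℝ →ᵇ ℝ) (lam : ℝ) {t : ℝ} (ht : t ∈ Icc (0 : ℝ) 1) :
    HasDerivWithinAt (pruferRadius Q lam)
      (pruferRadius Q lam t * pruferRadialField Q lam t (prufer Q lam t)) (Icc 0 1) t := by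
  have hθ := continuousOn_prufer Q lam
  refine (hasDerivWithinAt_unitPrimitive ?_ ht).exp
  unfold pruferRadialField
  have hs := Real.continuous_sin.comp_continuousOn hθ
  have hc := Real.continuous_cos.comp_continuousOn hθ
  have hQ : ContinuousOn Q (Icc 0 1) := Q.continuous.continuousOn
  exact (hs.mul ((hQ.mul hs).add hc)).add
    (hc.mul (((continuousOn_const.mul hs).sub (hQ.mul hc)).sub ((hQ.pow 2).mul hs)))

lemma isRegularisedSolution_prufer (Q : ℝ →ᵇ ℝ) (lam : ℝ) :
    IsRegularisedSolution Q lam (fun t => pruferRadius Q lam t * Real.sin (prufer Q lam t))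
      (fun t => pruferRadius Q lam t * Real.cos (prufer Q lam t)) := by
  intro t ht
  have hρ := hasDerivWithinAt_pruferRadius Q lam ht
  have hθ := hasDerivWithinAt_prufer Q lam ht
  have hsc := Real.sin_sq_add_cos_sq (prufer Q lam t)
  constructor
  · refine (hρ.mul hθ.sin).congr_deriv ?_
    simp only [pruferRadialField, pruferField]
    linear_combination (pruferRadius Q lam t * (Real.cos (prufer Q lam t) +
      Q t * Real.sin (prufer Q lam t))) * hsc
  · refine (hρ.mul hθ.cos).congr_deriv ?_
    simp only [pruferRadialField, pruferField]
    linear_combination (pruferRadius Q lam t * (-lam * Real.sin (prufer Q lam t) -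
      Q t * Real.cos (prufer Q lam t) - Q t ^ 2 * Real.sin (prufer Q lam t))) * hsc

/-- The Wronskian with the Prüfer solution is constant and zero at `0`, so `(ψ, v)` is parallel to
`(sin θ, cos θ)`. Its signed length divided by `ρ` is also constant, and nonzero as `ψ` is
nontrivial; so `ψ 1 = 0` forces `sin θ(1) = 0`. -/
lemma IsRegularisedSolution.sin_prufer_eq_zero {Q : ℝ →ᵇ ℝ} {lam : ℝ} {ψ v : ℝ → ℝ}
    (h : IsRegularisedSolution Q lam ψ v) (h0 : ψ 0 = 0) (h1 : ψ 1 = 0)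
    (hne : ∃ x ∈ Icc (0 : ℝ) 1, ψ x ≠ 0) : Real.sin (prufer Q lam 1) = 0 := by
  set θ := prufer Q lam
  set ρ := pruferRadius Q lam
  have hρ0 : ∀ t, ρ t ≠ 0 := fun t => (pruferRadius_pos Q lam t).ne'
  have hsol := isRegularisedSolution_prufer Q lam
  have hwronsk : ∀ t ∈ Icc (0 : ℝ) 1, ψ t * Real.cos (θ t) - v t * Real.sin (θ t) = 0 := by
    intro t ht
    have := eq_left_of_deriv_eq_zero (f := fun t => ψ t * (ρ t * Real.cos (θ t)) -
      v t * (ρ t * Real.sin (θ t)))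
      (fun t ht => ((h t ht).1.mul (hsol t ht).2).sub ((h t ht).2.mul (hsol t ht).1))
      (fun t _ => by ring) ht
    have hθ0 : θ 0 = 0 := prufer_zero Q lam
    simp only [h0, hθ0, Real.sin_zero, zero_mul, mul_zero, sub_zero] at this
    have e : ρ t * (ψ t * Real.cos (θ t) - v t * Real.sin (θ t)) = 0 := by linarith
    exact (mul_eq_zero.1 e).resolve_left (hρ0 t)
  have hψ : ∀ t ∈ Icc (0 : ℝ) 1,
      ψ t = (ψ t * Real.sin (θ t) + v t * Real.cos (θ t)) * Real.sin (θ t) := fun t ht => by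
    linear_combination (-ψ t) * Real.sin_sq_add_cos_sq (θ t) + Real.cos (θ t) * hwronsk t ht
  have hv : ∀ t ∈ Icc (0 : ℝ) 1,
      v t = (ψ t * Real.sin (θ t) + v t * Real.cos (θ t)) * Real.cos (θ t) := fun t ht => by
    linear_combination (-v t) * Real.sin_sq_add_cos_sq (θ t) - Real.sin (θ t) * hwronsk t ht
  have hratio : ∀ t ∈ Icc (0 : ℝ) 1,
      (ψ t * Real.sin (θ t) + v t * Real.cos (θ t)) / ρ t =
      (ψ 0 * Real.sin (θ 0) + v 0 * Real.cos (θ 0)) / ρ 0 := by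
    intro t ht
    refine eq_left_of_deriv_eq_zero
      (f := fun t => (ψ t * Real.sin (θ t) + v t * Real.cos (θ t)) / ρ t)
      (fun t ht => (((h t ht).1.mul (hasDerivWithinAt_prufer Q lam ht).sin).add
        ((h t ht).2.mul (hasDerivWithinAt_prufer Q lam ht).cos)).div
          (hasDerivWithinAt_pruferRadius Q lam ht) (hρ0 t)) (fun t ht => ?_) ht
    refine div_eq_zero_iff.2 (Or.inl ?_)
    have a1 := hψ t ht
    have a2 := hv t ht
    have hw := hwronsk t ht
    simp only [Pi.add_apply, Pi.mul_apply]
    change _ * ρ t - _ * (ρ t * _) = 0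
    generalize ψ t * Real.sin (θ t) + v t * Real.cos (θ t) = f at *
    have hθ : prufer Q lam t = θ t := rfl
    simp only [pruferRadialField, hθ]
    generalize pruferField Q lam t (θ t) = F at *
    generalize Real.sin (θ t) = s at *
    generalize Real.cos (θ t) = c at *
    rw [a1, a2]
    ring
  obtain ⟨x, hx, hxne⟩ := hne
  have hk : ψ x * Real.sin (θ x) + v x * Real.cos (θ x) ≠ 0 := fun h => by
    rw [hψ x hx, h, zero_mul] at hxne; exact hxne rfl
  have h1m : (1 : ℝ) ∈ Icc (0 : ℝ) 1 := by simp
  have e := (hratio 1 h1m).trans (hratio x hx).symm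
  have hne1 : ψ 1 * Real.sin (θ 1) + v 1 * Real.cos (θ 1) ≠ 0 := fun h => by
    rw [h, zero_div] at e
    exact div_ne_zero hk (hρ0 x) e.symm
  have := hψ 1 h1m
  rw [h1, eq_comm, mul_eq_zero] at this
  rw [h1] at hne1
  exact this.resolve_left hne1

section

variable {q : ℝ → ℝ}

lemma absolutelyContinuousOnInterval_primitive (hq : IntervalIntegrable q volume 0 1) :
    AbsolutelyContinuousOnInterval (fun x => ∫ t in (0 : ℝ)..x, q t) 0 1 :=
  hq.absolutelyContinuousOnInterval_intervalIntegral (by simp)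

lemma ae_hasDerivAt_primitive (hq : IntervalIntegrable q volume 0 1) :
    ∀ᵐ x ∂unitMeasure, HasDerivAt (fun x => ∫ t in (0 : ℝ)..x, q t) (q x) x :=
  ae_unit_of_ae (hq.ae_hasDerivAt_integral.mono fun _ hx hmem => hx hmem 0 (by simp))

/-- Differentiating `v + Q ψ` almost everywhere, the terms `Q v` and `Q² ψ` cancel and `(q - λ) ψ`
remains. -/
lemma IsRegularisedSolution.isDirichletEigenfunction (hq : IntervalIntegrable q volume 0 1)
    {lam : ℝ} {ψ v : ℝ → ℝ}
    (h : IsRegularisedSolution (fun x => ∫ t in (0 : ℝ)..x, q t) lam ψ v)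
    (h0 : ψ 0 = 0) (h1 : ψ 1 = 0) (hne : ∃ x ∈ Icc (0 : ℝ) 1, ψ x ≠ 0) :
    IsDirichletEigenfunction q lam ψ := by
  have hQ := absolutelyContinuousOnInterval_primitive hq
  have hQd := ae_hasDerivAt_primitive hq
  have hQc := hQ.continuousOn
  rw [uIcc_of_le zero_le_one] at hQc
  obtain ⟨hψc, hvc⟩ := h.continuousOn
  set Q : ℝ → ℝ := fun x => ∫ t in (0 : ℝ)..x, q t
  refine ⟨⟨fun t => v t + Q t * ψ t, fun t ht => (h t ht).1, ?_, ?_⟩, h0, h1, hne⟩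
  · refine AbsolutelyContinuousOnInterval.fun_add ?_ (hQ.fun_mul ?_)
    · exact absolutelyContinuousOnInterval_of_hasDerivWithinAt (fun t ht => (h t ht).2)
        (((continuousOn_const.mul hψc).sub (hQc.mul hvc)).sub ((hQc.pow 2).mul hψc))
    · exact absolutelyContinuousOnInterval_of_hasDerivWithinAt (fun t ht => (h t ht).1)
        (hvc.add (hQc.mul hψc))
  · filter_upwards [ae_mem_Ioo_unit, hQd] with t ht hQt
    have hn : Icc (0 : ℝ) 1 ∈ 𝓝 t := Icc_mem_nhds ht.1 ht.2
    obtain ⟨a, b⟩ := h t (Ioo_subset_Icc_self ht)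
    rw [((b.hasDerivAt hn).fun_add (hQt.fun_mul (a.hasDerivAt hn))).deriv]
    ring

/-- In `v = ψ' - Q ψ` the rough term `q ψ` cancels. So `v` is absolutely continuous with a
derivative equal almost everywhere to a continuous `g`; being the integral of `g`, it is
differentiable at every point. -/
lemma IsDirichletEigenfunction.exists_isRegularisedSolution
    (hq : IntervalIntegrable q volume 0 1) {lam : ℝ} {ψ : ℝ → ℝ}
    (h : IsDirichletEigenfunction q lam ψ) :
    ∃ v, IsRegularisedSolution (fun x => ∫ t in (0 : ℝ)..x, q t) lam ψ v := by
  have hQ := absolutelyContinuousOnInterval_primitive hq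
  have hQd := ae_hasDerivAt_primitive hq
  have hQc := hQ.continuousOn
  obtain ⟨⟨ψ', hd, hac, hode⟩, -⟩ := h
  have hψ'c := hac.continuousOn
  rw [uIcc_of_le zero_le_one] at hQc hψ'c
  have hψc : ContinuousOn ψ (Icc 0 1) := fun t ht => (hd t ht).continuousWithinAt
  set Q : ℝ → ℝ := fun x => ∫ t in (0 : ℝ)..x, q t
  set v : ℝ → ℝ := fun t => ψ' t - Q t * ψ t with hv
  have hvac : AbsolutelyContinuousOnInterval v 0 1 :=
    hac.fun_sub (hQ.fun_mul (absolutelyContinuousOnInterval_of_hasDerivWithinAt hd hψ'c))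
  have hvc := hvac.continuousOn
  rw [uIcc_of_le zero_le_one] at hvc
  set g : ℝ → ℝ := fun t => -lam * ψ t - Q t * v t - Q t ^ 2 * ψ t
  have hgc : ContinuousOn g (Icc 0 1) :=
    ((continuousOn_const.mul hψc).sub (hQc.mul hvc)).sub ((hQc.pow 2).mul hψc)
  have hderiv : ∀ᵐ x ∂unitMeasure, deriv v x = g x := by
    filter_upwards [ae_mem_Ioo_unit, hQd, hode, ae_unit_of_ae hac.ae_differentiableAt]
      with t ht hQt hodet hdiff
    have hn : Icc (0 : ℝ) 1 ∈ 𝓝 t := Icc_mem_nhds ht.1 ht.2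
    have := ((hd t (Ioo_subset_Icc_self ht)).hasDerivAt hn)
    rw [(hdiff.hasDerivAt.fun_sub (hQt.fun_mul this)).deriv]
    simp only [g, hv]
    linarith
  have hint : ∀ x ∈ Icc (0 : ℝ) 1, v x = v 0 + unitPrimitive g x := by
    intro x hx
    have hsub : uIcc 0 x ⊆ uIcc (0 : ℝ) 1 := by
      rw [uIcc_of_le hx.1, uIcc_of_le zero_le_one]; exact Icc_subset_Icc_right hx.2
    have e := (hvac.mono hsub).integral_deriv_eq_sub
    rw [unitPrimitive_eq hx, ← sub_eq_iff_eq_add', ← e]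
    refine intervalIntegral.integral_congr_ae ?_
    filter_upwards [(ae_restrict_iff' measurableSet_Icc).1 hderiv] with t ht hmem
    rw [uIoc_of_le hx.1] at hmem
    exact ht ⟨hmem.1.le, hmem.2.trans hx.2⟩
  refine ⟨v, fun t ht => ⟨(hd t ht).congr_deriv (by simp only [hv]; ring), ?_⟩⟩
  exact ((hasDerivWithinAt_unitPrimitive hgc ht).const_add (v 0)).congr (fun x hx => hint x hx)
    (hint t ht)

end

lemma IsRegularisedSolution.congr {Q Q' : ℝ → ℝ} {lam : ℝ} {ψ v : ℝ → ℝ}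
    (h : IsRegularisedSolution Q lam ψ v) (hQ : ∀ x ∈ Icc (0 : ℝ) 1, Q' x = Q x) :
    IsRegularisedSolution Q' lam ψ v := fun t ht => by
  rw [hQ t ht]; exact h t ht

theorem dirichletEigenvalues_eq_range {q : ℝ → ℝ} (hq : IntervalIntegrable q volume 0 1)
    {Q : ℝ →ᵇ ℝ} (hQ : ∀ x ∈ Icc (0 : ℝ) 1, Q x = ∫ t in (0 : ℝ)..x, q t) :
    dirichletEigenvalues q = range (pruferEigenvalue Q) := by
  ext lam
  rw [mem_range_pruferEigenvalue_iff]
  constructor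
  · rintro ⟨ψ, hψ⟩
    obtain ⟨v, hv⟩ := hψ.exists_isRegularisedSolution hq
    exact (hv.congr hQ).sin_prufer_eq_zero hψ.2.1 hψ.2.2.1 hψ.2.2.2
  · intro hs
    refine ⟨_, ((isRegularisedSolution_prufer Q lam).congr fun x hx =>
      (hQ x hx).symm).isDirichletEigenfunction hq (by simp) (by simp [hs]) ?_⟩
    obtain ⟨t, ht, hne⟩ := exists_sin_prufer_ne_zero Q lam
    exact ⟨t, Ioo_subset_Icc_self ht, mul_ne_zero (pruferRadius_pos Q lam t).ne' hne⟩

/-! ### The enumeration of the eigenvalues -/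

lemma dirichletEigenvalue_eq_of_strictMono {q : ℝ → ℝ} {e : ℕ → ℝ} (he : StrictMono e)
    (h : dirichletEigenvalues q = range e) : dirichletEigenvalue q = e := by
  funext n
  induction n with
  | zero =>
    rw [dirichletEigenvalue, h]
    refine IsLeast.csInf_eq ⟨⟨0, rfl⟩, ?_⟩
    rintro _ ⟨k, rfl⟩
    exact he.monotone (Nat.zero_le k)
  | succ n ih =>
    rw [dirichletEigenvalue, h, ih]
    refine IsLeast.csInf_eq ⟨⟨⟨n + 1, rfl⟩, he n.lt_succ_self⟩, ?_⟩
    rintro _ ⟨⟨k, rfl⟩, hk⟩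
    exact he.monotone (he.lt_iff_lt.1 hk)

theorem dirichletEigenvalue_eq {q : ℝ → ℝ} (hq : IntervalIntegrable q volume 0 1)
    {Q : ℝ →ᵇ ℝ} (hQ : ∀ x ∈ Icc (0 : ℝ) 1, Q x = ∫ t in (0 : ℝ)..x, q t) :
    dirichletEigenvalue q = pruferEigenvalue Q :=
  dirichletEigenvalue_eq_of_strictMono (strictMono_pruferEigenvalue Q)
    (dirichletEigenvalues_eq_range hq hQ)

lemma mem_dirichletEigenvalues_add_const {q q' : ℝ → ℝ} {c : ℝ}
    (h : ∀ᵐ x ∂unitMeasure, q' x = q x + c) {lam : ℝ} (hlam : lam ∈ dirichletEigenvalues q) :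
    lam + c ∈ dirichletEigenvalues q' := by
  obtain ⟨ψ, ⟨ψ', hd, hac, hode⟩, hb⟩ := hlam
  refine ⟨ψ, ⟨ψ', hd, hac, ?_⟩, hb⟩
  filter_upwards [h, hode] with x hx hox
  rw [hx]
  linarith

lemma dirichletEigenvalue_add_const {q q' : ℝ → ℝ} {c : ℝ}
    (h : ∀ᵐ x ∂unitMeasure, q' x = q x + c) (hm : StrictMono (dirichletEigenvalue q))
    (hr : range (dirichletEigenvalue q) = dirichletEigenvalues q) (n : ℕ) :
    dirichletEigenvalue q' n = dirichletEigenvalue q n + c := by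
  have : dirichletEigenvalue q' = fun n => dirichletEigenvalue q n + c := by
    refine dirichletEigenvalue_eq_of_strictMono (fun a b hab => by simpa using hm hab) ?_
    ext lam
    constructor
    · intro hlam
      have := mem_dirichletEigenvalues_add_const (q := q') (q' := q) (c := -c)
        (h.mono fun x hx => by rw [hx]; ring) hlam
      rw [← hr] at this
      obtain ⟨k, hk⟩ := this
      exact ⟨k, by simp only [hk]; ring⟩
    · rintro ⟨k, rfl⟩
      exact mem_dirichletEigenvalues_add_const h (hr ▸ mem_range_self k)
  rw [this]

/-! ### Difference quotients of primitives -/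

instance isProbabilityMeasure_unitMeasure : IsProbabilityMeasure unitMeasure :=
  ⟨by simp [unitMeasure]⟩

/-- Jensen's inequality on a probability space. -/
lemma lintegral_enorm_rpow_le {f : ℝ → ℝ} {s : ℝ} (hs : 1 ≤ s)
    (hf : AEStronglyMeasurable f unitMeasure) :
    (∫⁻ x, ‖f x‖ₑ ∂unitMeasure) ^ s ≤ ∫⁻ x, ‖f x‖ₑ ^ s ∂unitMeasure := by
  have hs0 : 0 < s := one_pos.trans_le hs
  have h := eLpNorm'_le_eLpNorm'_of_exponent_le one_pos hs unitMeasure hf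
  rw [eLpNorm'_eq_lintegral_enorm, eLpNorm'_eq_lintegral_enorm] at h
  simp only [ENNReal.rpow_one, div_one] at h
  have h2 := ENNReal.rpow_le_rpow h hs0.le
  rwa [← ENNReal.rpow_mul, one_div, inv_mul_cancel₀ hs0.ne', ENNReal.rpow_one] at h2

/-- Averaging over intervals does not increase the `L^p` norm. -/
lemma eLpNorm_difference_quotient_le {p : ℝ≥0∞} (hp1 : 1 ≤ p) (hp : p ≠ ∞) {f : ℝ → ℝ}
    (hf : StronglyMeasurable f) (hi : Integrable f) {h : ℝ} (hh : 0 < h) :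
    eLpNorm (fun x => h⁻¹ * ((∫ t in (0 : ℝ)..(x + h), f t) - ∫ t in (0 : ℝ)..x, f t)) p volume ≤
      eLpNorm f p volume := by
  have hp0 : p ≠ 0 := (one_pos.trans_le hp1).ne'
  have hs : 1 ≤ p.toReal := by
    rw [← ENNReal.toReal_one]; exact ENNReal.toReal_mono hp hp1
  rw [eLpNorm_eq_lintegral_rpow_enorm_toReal hp0 hp, eLpNorm_eq_lintegral_rpow_enorm_toReal hp0 hp]
  refine ENNReal.rpow_le_rpow ?_ (by positivity)
  have hm : Measurable fun z : ℝ × ℝ => ‖f (z.1 + h * z.2)‖ₑ ^ p.toReal :=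
    (hf.measurable.comp (by fun_prop : Measurable fun z : ℝ × ℝ => z.1 + h * z.2)).enorm.pow_const _
  calc _ ≤ ∫⁻ x, ∫⁻ s, ‖f (x + h * s)‖ₑ ^ p.toReal ∂unitMeasure := by
        refine lintegral_mono fun x => ?_
        -- The quotient is the mean of the translates `f (x + h s)` over `s` in `[0, 1]`; Jensen,
        -- Tonelli and translation invariance then give the bound.
        have e : h⁻¹ * ((∫ t in (0 : ℝ)..(x + h), f t) - ∫ t in (0 : ℝ)..x, f t) =
            ∫ s, f (x + h * s) ∂unitMeasure := by
          rw [intervalIntegral.integral_interval_sub_left hi.intervalIntegrable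
            hi.intervalIntegrable, unitMeasure, integral_Icc_eq_integral_Ioc,
            ← intervalIntegral.integral_of_le zero_le_one,
            intervalIntegral.integral_comp_add_mul f hh.ne' x]
          simp
        simp only [e]
        refine (ENNReal.rpow_le_rpow (enorm_integral_le_lintegral_enorm _) (by positivity)).trans ?_
        exact lintegral_enorm_rpow_le hs
          (hf.comp_measurable (by fun_prop : Measurable fun s : ℝ => x + h * s)).aestronglyMeasurable
    _ = ∫⁻ s, (∫⁻ x, ‖f (x + h * s)‖ₑ ^ p.toReal) ∂unitMeasure :=
        lintegral_lintegral_swap hm.aemeasurable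
    _ = ∫⁻ _, (∫⁻ x, ‖f x‖ₑ ^ p.toReal) ∂unitMeasure := by
        refine lintegral_congr fun s => ?_
        exact lintegral_add_right_eq_self (fun x => ‖f x‖ₑ ^ p.toReal) (h * s)
    _ = _ := by simp

/-! ### Compactness of the set of primitives -/

/-- The constant extension of a function on the unit interval to the real line. -/
def constExtend (Q : Icc (0 : ℝ) 1 →ᵇ ℝ) : ℝ →ᵇ ℝ :=
  Q.compContinuous ⟨projIcc (0 : ℝ) 1 zero_le_one, continuous_projIcc⟩

lemma constExtend_apply (Q : Icc (0 : ℝ) 1 →ᵇ ℝ) (x : ℝ) :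
    constExtend Q x = Q (projIcc 0 1 zero_le_one x) := rfl

lemma constExtend_of_mem (Q : Icc (0 : ℝ) 1 →ᵇ ℝ) {x : ℝ} (hx : x ∈ Icc (0 : ℝ) 1) :
    constExtend Q x = Q ⟨x, hx⟩ := by rw [constExtend_apply, projIcc_of_mem]

lemma continuous_constExtend : Continuous constExtend := continuous_compContinuous _

lemma Potential.integrable {p : ℝ≥0∞} (hp1 : 1 ≤ p) (q : Potential p) : Integrable q unitMeasure :=
  (Lp.memLp q).integrable hp1

lemma Potential.intervalIntegrable {p : ℝ≥0∞} (hp1 : 1 ≤ p) (q : Potential p) :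
    IntervalIntegrable q volume 0 1 :=
  (intervalIntegrable_iff_integrableOn_Icc_of_le zero_le_one).2 (Potential.integrable hp1 q)

lemma eLpNorm_le_of_mem_potentialBall {p : ℝ≥0∞} {r : ℝ} (hr : 0 ≤ r) {q : Potential p}
    (hq : q ∈ potentialBall p r) : eLpNorm q p unitMeasure ≤ ENNReal.ofReal r := by
  rw [ENNReal.le_ofReal_iff_toReal_le (Lp.eLpNorm_ne_top q) hr, ← Lp.norm_def]
  exact hq

/-- The set of primitives of the potentials in the ball of radius `r`. -/
def primitives (p : ℝ≥0∞) (r : ℝ) : Set (Icc (0 : ℝ) 1 →ᵇ ℝ) :=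
  {Q | ∃ q ∈ potentialBall p r, ∀ x : Icc (0 : ℝ) 1, Q x = ∫ t in (0 : ℝ)..x, q t}

lemma exists_primitive {p : ℝ≥0∞} (hp1 : 1 ≤ p) (q : Potential p) :
    ∃ Q : Icc (0 : ℝ) 1 →ᵇ ℝ, ∀ x : Icc (0 : ℝ) 1, Q x = ∫ t in (0 : ℝ)..x, q t := by
  have hc := (absolutelyContinuousOnInterval_primitive
    (Potential.intervalIntegrable hp1 q)).continuousOn
  rw [uIcc_of_le zero_le_one] at hc
  exact ⟨mkOfCompact ⟨_, hc.domRestrict⟩, fun x => rfl⟩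

section

open AbsolutelyContinuousOnInterval

/-- Hölder's inequality against the constant `1` on `S`. -/
lemma setIntegral_norm_le {p : ℝ≥0∞} (hp1 : 1 ≤ p) {r : ℝ} (hr : 0 ≤ r) {q : Potential p}
    (hq : q ∈ potentialBall p r) {S : Set ℝ} (hS : S ⊆ Icc 0 1) {d : ℝ} (hd : 0 ≤ d)
    (hSd : volume S ≤ ENNReal.ofReal d) :
    ∫ x in S, ‖q x‖ ≤ r * d ^ (1 - 1 / p.toReal) := by
  have hle : volume.restrict S ≤ unitMeasure := Measure.restrict_mono hS le_rfl
  have hm : AEStronglyMeasurable q (volume.restrict S) := (Lp.aestronglyMeasurable q).mono_measure hle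
  have hκ : 0 ≤ 1 - 1 / p.toReal := by
    rcases eq_or_ne p ∞ with rfl | hp
    · simp
    · have hs : 1 ≤ p.toReal := by
        rw [← ENNReal.toReal_one]; exact ENNReal.toReal_mono hp hp1
      rw [sub_nonneg, one_div]; exact inv_le_one_of_one_le₀ hs
  have hn := eLpNorm_le_of_mem_potentialBall hr hq
  have h := eLpNorm_le_eLpNorm_mul_rpow_measure_univ hp1 hm
  rw [eLpNorm_one_eq_lintegral_enorm, Measure.restrict_apply_univ, ENNReal.toReal_one,
    div_one] at h
  rw [integral_norm_eq_lintegral_enorm hm]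
  refine ENNReal.toReal_le_of_le_ofReal (by positivity) (h.trans ?_)
  rw [ENNReal.ofReal_mul hr, ← ENNReal.ofReal_rpow_of_nonneg hd hκ]
  gcongr
  exact (eLpNorm_mono_measure _ hle).trans hn

/-- The bound covers finite disjoint families because it must yield absolute continuity of uniform
limits; a single interval gives the Hölder modulus. -/
lemma sum_dist_primitive_le {p : ℝ≥0∞} (hp1 : 1 ≤ p) {r : ℝ} (hr : 0 ≤ r) {q : Potential p}
    (hq : q ∈ potentialBall p r) {E : ℕ × (ℕ → ℝ × ℝ)} (hE : E ∈ disjWithin 0 1) :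
    ∑ i ∈ Finset.range E.1, dist (∫ t in (0 : ℝ)..(E.2 i).1, q t) (∫ t in (0 : ℝ)..(E.2 i).2, q t)
      ≤ r * (∑ i ∈ Finset.range E.1, dist (E.2 i).1 (E.2 i).2) ^ (1 - 1 / p.toReal) := by
  have hii := Potential.intervalIntegrable hp1 q
  obtain ⟨hmem, hdisj⟩ := hE
  have hsub : ⋃ i ∈ Finset.range E.1, uIoc (E.2 i).1 (E.2 i).2 ⊆ uIoc (0 : ℝ) 1 :=
    biUnion_uIoc_subset_of_mem_disjWithin ⟨hmem, hdisj⟩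
  have hIoc : uIoc (0 : ℝ) 1 ⊆ Icc 0 1 := by
    rw [uIoc_of_le zero_le_one]; exact Ioc_subset_Icc_self
  refine le_trans ?_ (setIntegral_norm_le hp1 hr hq (hsub.trans hIoc)
    (Finset.sum_nonneg fun _ _ => dist_nonneg) ?_)
  · rw [integral_biUnion_finset _ (fun _ _ => measurableSet_uIoc) hdisj]
    · refine Finset.sum_le_sum fun i hi => ?_
      rw [Real.dist_eq, intervalIntegral.integral_interval_sub_left, uIoc_comm,
        ← Real.norm_eq_abs]
      · exact intervalIntegral.norm_integral_le_integral_norm_uIoc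
      · exact hii.mono_set (uIcc_subset_uIcc left_mem_uIcc (hmem i hi).1)
      · exact hii.mono_set (uIcc_subset_uIcc left_mem_uIcc (hmem i hi).2)
    · intro i hi
      refine IntegrableOn.mono_set (t := uIoc (0 : ℝ) 1) ?_
        (uIoc_subset_of_mem_disjWithin ⟨hmem, hdisj⟩ (Finset.mem_range.1 hi))
      exact (intervalIntegrable_iff.1 hii).norm
  · refine (measure_biUnion_finset_le _ _).trans ?_
    rw [ENNReal.ofReal_sum_of_nonneg fun _ _ => dist_nonneg]
    refine Finset.sum_le_sum fun i _ => ?_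
    rw [uIoc, Real.volume_Ioc, max_sub_min_eq_abs, Real.dist_eq, abs_sub_comm]

end

lemma dist_primitive_le {p : ℝ≥0∞} (hp1 : 1 ≤ p) {r : ℝ} (hr : 0 ≤ r)
    {Q : Icc (0 : ℝ) 1 →ᵇ ℝ} (hQ : Q ∈ primitives p r) (x y : Icc (0 : ℝ) 1) :
    dist (Q x) (Q y) ≤ r * dist x y ^ (1 - 1 / p.toReal) := by
  obtain ⟨q, hq, hQ⟩ := hQ
  have h := sum_dist_primitive_le hp1 hr hq (E := (1, fun _ => (x, y)))
    ⟨fun _ _ => by rw [uIcc_of_le zero_le_one]; exact ⟨x.2, y.2⟩, by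
      simp [Set.PairwiseDisjoint]⟩
  simpa [← hQ, Subtype.dist_eq] using h

/-- Extending the primitive by constants amounts to extending the potential by zero, so the estimate
for difference quotients on the whole line applies. -/
lemma constExtend_eq_integral {q : ℝ → ℝ} (hq : IntervalIntegrable q volume 0 1)
    {Q : Icc (0 : ℝ) 1 →ᵇ ℝ} (hQ : ∀ x : Icc (0 : ℝ) 1, Q x = ∫ t in (0 : ℝ)..x, q t) (x : ℝ) :
    constExtend Q x = ∫ t in (0 : ℝ)..x, (Ioc (0 : ℝ) 1).indicator q t := by
  have hmid : ∀ y ∈ Icc (0 : ℝ) 1,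
      ∫ t in (0 : ℝ)..y, (Ioc (0 : ℝ) 1).indicator q t = ∫ t in (0 : ℝ)..y, q t := fun y hy => by
    refine intervalIntegral.integral_congr_ae (Eventually.of_forall fun t ht => ?_)
    rw [uIoc_of_le hy.1] at ht
    exact indicator_of_mem (s := Ioc (0 : ℝ) 1) ⟨ht.1, ht.2.trans hy.2⟩ q
  have hi : Integrable ((Ioc (0 : ℝ) 1).indicator q) :=
    (integrable_indicator_iff measurableSet_Ioc).2
      ((intervalIntegrable_iff_integrableOn_Ioc_of_le zero_le_one).1 hq)
  have hz : ∀ a b : ℝ, Disjoint (uIoc a b) (Ioc 0 1) →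
      ∫ t in a..b, (Ioc (0 : ℝ) 1).indicator q t = 0 := fun a b hd =>
    intervalIntegral.integral_zero_ae (ae_of_all _ fun t ht =>
      indicator_of_notMem (Set.disjoint_left.1 hd ht) q)
  rcases lt_or_ge x 0 with h0 | h0
  · rw [constExtend_apply, projIcc_of_le_left _ h0.le, hQ, hz]
    · simp
    · rw [uIoc_of_ge h0.le]
      exact Set.disjoint_left.2 fun t ht ht' => (ht'.1.trans_le ht.2).false
  rcases le_or_gt x 1 with h1 | h1
  · rw [constExtend_of_mem Q ⟨h0, h1⟩, hQ, hmid x ⟨h0, h1⟩]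
  · rw [constExtend_apply, projIcc_of_right_le _ h1.le, hQ,
      ← intervalIntegral.integral_add_adjacent_intervals (b := 1) hi.intervalIntegrable
        hi.intervalIntegrable, hz 1 x, add_zero, hmid 1 (by simp)]
    rw [uIoc_of_le h1.le]
    exact Set.disjoint_left.2 fun t ht ht' => (ht.1.trans_le ht'.2).false

lemma eLpNorm_difference_quotient_constExtend_le {p : ℝ≥0∞} (hp1 : 1 ≤ p) (hp : p ≠ ∞) {r : ℝ}
    (hr : 0 ≤ r) {Q : Icc (0 : ℝ) 1 →ᵇ ℝ} (hQ : Q ∈ primitives p r) {h : ℝ} (hh : 0 < h) :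
    eLpNorm (fun x => h⁻¹ * (constExtend Q (x + h) - constExtend Q x)) p volume ≤
      ENNReal.ofReal r := by
  obtain ⟨q, hq, hQ⟩ := hQ
  have hii := Potential.intervalIntegrable hp1 q
  have hi : Integrable ((Ioc (0 : ℝ) 1).indicator q) :=
    (integrable_indicator_iff measurableSet_Ioc).2
      ((intervalIntegrable_iff_integrableOn_Ioc_of_le zero_le_one).1 hii)
  simp only [constExtend_eq_integral hii hQ]
  refine (eLpNorm_difference_quotient_le hp1 hp
    ((Lp.stronglyMeasurable q).indicator measurableSet_Ioc) hi hh).trans ?_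
  rw [eLpNorm_indicator_eq_eLpNorm_restrict measurableSet_Ioc,
    Measure.restrict_congr_set Ioc_ae_eq_Icc]
  exact eLpNorm_le_of_mem_potentialBall hr hq

/-- The uniform modulus of absolute continuity survives the limit, so `Q` is the integral of its
derivative. The norm bound on that derivative comes from applying Fatou's lemma twice to difference
quotients: along the sequence at fixed step, then as the step tends to zero. -/
lemma isClosed_primitives {p : ℝ≥0∞} (hp1 : 1 < p) (hp : p ≠ ∞) {r : ℝ} (hr : 0 ≤ r) :
    IsClosed (primitives p r) := by
  rw [← isSeqClosed_iff_isClosed]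
  intro Qn Q hQn hlim
  have hpt : ∀ x, Tendsto (fun n => constExtend (Qn n) x) atTop (𝓝 (constExtend Q x)) := fun x =>
    ((continuous_eval_const x).comp continuous_constExtend).tendsto Q |>.comp hlim
  have hs : 1 < p.toReal := by
    rw [← ENNReal.toReal_one]; exact (ENNReal.toReal_lt_toReal (by simp) hp).2 hp1
  have hκ : 0 < 1 - 1 / p.toReal := by
    rw [sub_pos, one_div]; exact inv_lt_one_of_one_lt₀ hs
  have hac : AbsolutelyContinuousOnInterval (constExtend Q) 0 1 := by
    have hb : ∀ E ∈ AbsolutelyContinuousOnInterval.disjWithin 0 1,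
        ∑ i ∈ Finset.range E.1, dist (constExtend Q (E.2 i).1) (constExtend Q (E.2 i).2) ≤
        r * (∑ i ∈ Finset.range E.1, dist (E.2 i).1 (E.2 i).2) ^ (1 - 1 / p.toReal) := by
      intro E hE
      refine le_of_tendsto' (tendsto_finsetSum _ fun i _ =>
        (hpt (E.2 i).1).dist (hpt (E.2 i).2)) fun n => ?_
      obtain ⟨q, hq, hQ⟩ := hQn n
      refine le_trans (le_of_eq ?_) (sum_dist_primitive_le hp1.le hr hq hE)
      refine Finset.sum_congr rfl fun i hi => ?_
      have hm := hE.1 i hi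
      rw [uIcc_of_le zero_le_one] at hm
      rw [constExtend_of_mem _ hm.1, constExtend_of_mem _ hm.2, hQ, hQ]
    refine squeeze_zero' (g := fun E : ℕ × (ℕ → ℝ × ℝ) =>
      r * (∑ i ∈ Finset.range E.1, dist (E.2 i).1 (E.2 i).2) ^ (1 - 1 / p.toReal))
      (Eventually.of_forall fun E => Finset.sum_nonneg fun _ _ => dist_nonneg)
      (eventually_inf_principal.2 (Eventually.of_forall hb)) ?_
    have hc : Continuous fun y : ℝ => r * y ^ (1 - 1 / p.toReal) :=
      continuous_const.mul (Real.continuous_rpow_const hκ.le)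
    have := (hc.tendsto 0).comp (tendsto_comap.mono_left inf_le_left :
      Tendsto (fun E : ℕ × (ℕ → ℝ × ℝ) => ∑ i ∈ Finset.range E.1, dist (E.2 i).1 (E.2 i).2)
        (AbsolutelyContinuousOnInterval.totalLengthFilter ⊓
          𝓟 (AbsolutelyContinuousOnInterval.disjWithin 0 1)) (𝓝 0))
    rwa [Real.zero_rpow hκ.ne', mul_zero] at this
  have hquot : ∀ h : ℝ, 0 < h →
      eLpNorm (fun x => h⁻¹ * (constExtend Q (x + h) - constExtend Q x)) p volume ≤
        ENNReal.ofReal r := by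
    intro h hh
    refine (Lp.eLpNorm_lim_le_liminf_eLpNorm
      (f := fun n x => h⁻¹ * (constExtend (Qn n) (x + h) - constExtend (Qn n) x))
      (fun n => Continuous.aestronglyMeasurable (by fun_prop)) _
      (ae_of_all _ fun x => ((hpt (x + h)).sub (hpt x)).const_mul h⁻¹)).trans ?_
    refine liminf_le_of_le (by isBoundedDefault) fun b hb => ?_
    obtain ⟨n, hn⟩ := hb.exists
    exact hn.trans (eLpNorm_difference_quotient_constExtend_le hp1.le hp hr (hQn n) hh)
  have hnorm : eLpNorm (deriv (constExtend Q)) p unitMeasure ≤ ENNReal.ofReal r := by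
    refine (Lp.eLpNorm_lim_le_liminf_eLpNorm
      (f := fun (n : ℕ) x => (1 / ((n : ℝ) + 1))⁻¹ *
        (constExtend Q (x + 1 / ((n : ℝ) + 1)) - constExtend Q x))
      (fun n => Continuous.aestronglyMeasurable (by fun_prop)) _ ?_).trans ?_
    · filter_upwards [ae_unit_of_ae hac.ae_differentiableAt] with x hx
      have h1 : Tendsto (fun n : ℕ => 1 / ((n : ℝ) + 1)) atTop (𝓝[>] 0) :=
        tendsto_nhdsWithin_iff.2 ⟨tendsto_one_div_add_atTop_nhds_zero_nat,
          Eventually.of_forall fun n => by simp only [mem_Ioi]; positivity⟩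
      exact hx.hasDerivAt.tendsto_slope_zero_right.comp h1
    · refine liminf_le_of_le (by isBoundedDefault) fun b hb => ?_
      obtain ⟨n, hn⟩ := hb.exists
      exact hn.trans ((eLpNorm_mono_measure _ Measure.restrict_le_self).trans
        (hquot _ (by positivity)))
  have hmem : MemLp (deriv (constExtend Q)) p unitMeasure :=
    ⟨(measurable_deriv _).aestronglyMeasurable, hnorm.trans_lt ENNReal.ofReal_lt_top⟩
  refine ⟨hmem.toLp _, ?_, fun x => ?_⟩
  · change ‖hmem.toLp _‖ ≤ r
    rw [Lp.norm_toLp]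
    exact ENNReal.toReal_le_of_le_ofReal hr hnorm
  · have hsub : uIcc (0 : ℝ) x ⊆ uIcc (0 : ℝ) 1 := by
      rw [uIcc_of_le x.2.1, uIcc_of_le zero_le_one]; exact Icc_subset_Icc_right x.2.2
    have e := (hac.mono hsub).integral_deriv_eq_sub
    have h0 : constExtend Q 0 = 0 := by
      refine tendsto_nhds_unique (hpt 0) ?_
      refine tendsto_const_nhds.congr fun n => ?_
      obtain ⟨q, hq, hQ⟩ := hQn n
      rw [constExtend_of_mem _ (left_mem_Icc.2 zero_le_one), hQ]
      simp
    rw [h0, sub_zero, constExtend_of_mem Q x.2] at e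
    rw [← e]
    refine intervalIntegral.integral_congr_ae ?_
    filter_upwards [(ae_restrict_iff' measurableSet_Icc).1 hmem.coeFn_toLp] with t ht hm
    rw [uIoc_of_le x.2.1] at hm
    exact (ht ⟨hm.1.le, hm.2.trans x.2.2⟩).symm

/-- Every primitive vanishes at `0`, so the common Hölder modulus provides both the bound `r` and
equicontinuity. -/
theorem isCompact_primitives {p : ℝ≥0∞} (hp1 : 1 < p) (hp : p ≠ ∞) {r : ℝ} (hr : 0 ≤ r) :
    IsCompact (primitives p r) := by
  have hs : 1 < p.toReal := by
    rw [← ENNReal.toReal_one]; exact (ENNReal.toReal_lt_toReal (by simp) hp).2 hp1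
  have hκ : 0 < 1 - 1 / p.toReal := by
    rw [sub_pos, one_div]; exact inv_lt_one_of_one_lt₀ hs
  refine arzela_ascoli₂ (Metric.closedBall 0 r) (isCompact_closedBall 0 r) _
    (isClosed_primitives hp1 hp hr) (fun Q x hQ => ?_) ?_
  · have h := dist_primitive_le hp1.le hr hQ x 0
    have h0 : Q 0 = 0 := by
      obtain ⟨q, hq, hQ⟩ := hQ
      rw [hQ]; simp
    rw [h0] at h
    have hd : dist x 0 ≤ 1 := by
      rw [Subtype.dist_eq, Real.dist_eq, Icc.coe_zero, sub_zero, abs_of_nonneg x.2.1]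
      exact x.2.2
    refine h.trans (mul_le_of_le_one_right hr (Real.rpow_le_one dist_nonneg hd hκ.le))
  · refine Metric.equicontinuous_of_continuity_modulus (fun d => r * d ^ (1 - 1 / p.toReal)) ?_ _
      fun x y Q => dist_primitive_le hp1.le hr Q.2 x y
    have hc : Continuous fun y : ℝ => r * y ^ (1 - 1 / p.toReal) :=
      continuous_const.mul (Real.continuous_rpow_const hκ.le)
    have := hc.tendsto 0
    rwa [Real.zero_rpow hκ.ne', mul_zero] at this

/-! ### The extremal potentials -/

lemma dirichletEigenvalue_eq_constExtend {p : ℝ≥0∞} (hp1 : 1 ≤ p) (q : Potential p)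
    {Q : Icc (0 : ℝ) 1 →ᵇ ℝ} (hQ : ∀ x : Icc (0 : ℝ) 1, Q x = ∫ t in (0 : ℝ)..x, q t) :
    dirichletEigenvalue q = pruferEigenvalue (constExtend Q) :=
  dirichletEigenvalue_eq (Potential.intervalIntegrable hp1 q) fun x hx => by
    rw [constExtend_of_mem Q hx, hQ]

lemma strictMono_dirichletEigenvalue {p : ℝ≥0∞} (hp1 : 1 ≤ p) (q : Potential p) :
    StrictMono (dirichletEigenvalue q) ∧
      range (dirichletEigenvalue q) = dirichletEigenvalues q := by
  obtain ⟨Q, hQ⟩ := exists_primitive hp1 q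
  rw [dirichletEigenvalue_eq_constExtend hp1 q hQ]
  refine ⟨strictMono_pruferEigenvalue _, ?_⟩
  exact (dirichletEigenvalues_eq_range (Potential.intervalIntegrable hp1 q) fun x hx => by
    rw [constExtend_of_mem Q hx, hQ]).symm

lemma eigenvalueSum_add_const {p : ℝ≥0∞} (hp1 : 1 ≤ p) (m : ℕ) (q : Potential p) (c : ℝ) :
    eigenvalueSum m (q + Lp.const p unitMeasure c : Potential p) = eigenvalueSum m q + m * c := by
  obtain ⟨hm, hr⟩ := strictMono_dirichletEigenvalue hp1 q
  have h : ∀ᵐ x ∂unitMeasure, (q + Lp.const p unitMeasure c : Potential p) x = q x + c := by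
    filter_upwards [Lp.coeFn_add q (Lp.const p unitMeasure c), Lp.coeFn_const p unitMeasure c]
      with x h1 h2
    rw [h1, Pi.add_apply, h2, Function.const_apply]
  simp only [eigenvalueSum, dirichletEigenvalue_add_const h hm hr, Finset.sum_add_distrib,
    Finset.sum_const, Finset.card_range, nsmul_eq_mul]

lemma norm_const_unitMeasure {p : ℝ≥0∞} (hp1 : 1 ≤ p) (c : ℝ) :
    ‖Lp.const p unitMeasure c‖ = |c| := by
  rw [Lp.norm_const p unitMeasure (c := c) (one_pos.trans_le hp1).ne']
  simp

lemma exists_isExtr_eigenvalueSum {p : ℝ≥0∞} (hp1 : 1 < p) (hp : p ≠ ∞) {r : ℝ} (hr : 0 ≤ r)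
    (m : ℕ) : ∃ qminus ∈ potentialBall p r, ∃ qplus ∈ potentialBall p r,
      ∀ q ∈ potentialBall p r,
        eigenvalueSum m qminus ≤ eigenvalueSum m q ∧ eigenvalueSum m q ≤ eigenvalueSum m qplus := by
  have : Fact (1 ≤ p) := ⟨hp1.le⟩
  have hK := isCompact_primitives hp1 hp hr
  have hne : (primitives p r).Nonempty := by
    obtain ⟨Q, hQ⟩ := exists_primitive hp1.le (0 : Potential p)
    exact ⟨Q, 0, by simpa [potentialBall] using hr, hQ⟩
  have hc : Continuous fun Q : Icc (0 : ℝ) 1 →ᵇ ℝ =>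
      ∑ i ∈ Finset.range m, pruferEigenvalue (constExtend Q) i :=
    continuous_finsetSum _ fun i _ => (continuous_pruferEigenvalue i).comp continuous_constExtend
  obtain ⟨Q₁, ⟨q₁, hq₁, hQ₁⟩, hmin⟩ := hK.exists_isMinOn hne hc.continuousOn
  obtain ⟨Q₂, ⟨q₂, hq₂, hQ₂⟩, hmax⟩ := hK.exists_isMaxOn hne hc.continuousOn
  refine ⟨q₁, hq₁, q₂, hq₂, fun q hq => ?_⟩
  obtain ⟨Q, hQ⟩ := exists_primitive hp1.le q
  simp only [eigenvalueSum, dirichletEigenvalue_eq_constExtend hp1.le q hQ,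
    dirichletEigenvalue_eq_constExtend hp1.le q₁ hQ₁,
    dirichletEigenvalue_eq_constExtend hp1.le q₂ hQ₂]
  exact ⟨hmin ⟨q, hq, hQ⟩, hmax ⟨q, hq, hQ⟩⟩

end

end

theorem theorem3p3 (p : ℝ≥0∞) (hp1 : 1 < p) (hp : p ≠ ∞) (r : ℝ) (hr : 0 < r)
    (m : ℕ) (hm : 2 ≤ m) :
    -- the eigenvalues form a strictly increasing sequence, so that their enumeration,
    -- and with it the sum of the first `m` of them, is meaningful
    (∀ q : Potential p, StrictMono (dirichletEigenvalue q) ∧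
      Set.range (dirichletEigenvalue q) = dirichletEigenvalues q) ∧
    ∃ qminus qplus : Potential p, ‖qminus‖ = r ∧ ‖qplus‖ = r ∧
      IsLeast ((fun q : Potential p => eigenvalueSum m q) '' potentialBall p r)
        (eigenvalueSum m qminus) ∧
      IsGreatest ((fun q : Potential p => eigenvalueSum m q) '' potentialBall p r)
        (eigenvalueSum m qplus) := by
  have : Fact (1 ≤ p) := ⟨hp1.le⟩
  refine ⟨strictMono_dirichletEigenvalue hp1.le, ?_⟩
  obtain ⟨q₁, hq₁, q₂, hq₂, h⟩ := exists_isExtr_eigenvalueSum hp1 hp hr.le m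
  have hm0 : (0 : ℝ) < m := by exact_mod_cast two_pos.trans_le hm
  have shift : ∀ (q : Potential p) (c : ℝ), ‖q‖ + |c| ≤ r →
      (q + Lp.const p unitMeasure c : Potential p) ∈ potentialBall p r := fun q c hc =>
    (norm_add_le _ _).trans (by rwa [norm_const_unitMeasure hp1.le])
  refine ⟨q₁, q₂, ?_, ?_, ⟨⟨q₁, hq₁, rfl⟩, ?_⟩, ⟨q₂, hq₂, rfl⟩, ?_⟩
  -- Lowering `q₁` by its slack `r - ‖q₁‖` stays in the ball and lowers the sum by `m (r - ‖q₁‖) >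
  -- 0`; the maximizer is raised in the same way.
  · refine le_antisymm hq₁ (not_lt.1 fun hlt => ?_)
    have h1 := (h _ (shift q₁ (-(r - ‖q₁‖)) (by
      rw [abs_neg, abs_of_pos (sub_pos.2 hlt)]; linarith))).1
    rw [eigenvalueSum_add_const hp1.le] at h1
    nlinarith
  · refine le_antisymm hq₂ (not_lt.1 fun hlt => ?_)
    have h1 := (h _ (shift q₂ (r - ‖q₂‖) (by
      rw [abs_of_pos (sub_pos.2 hlt)]; linarith))).2
    rw [eigenvalueSum_add_const hp1.le] at h1
    nlinarith
  · rintro _ ⟨q, hq, rfl⟩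
    exact (h q hq).1
  · rintro _ ⟨q, hq, rfl⟩
    exact (h q hq).2
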